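/- Let $r\ge 2$ be an integer and let $\theta=(\mu,\sigma,\xi)$ with $\mu,\xi\in\mathbb R$ and $\sigma>0$. For $k\ge 1$, the $\mathrm{GEV}_k(\theta)$ distribution is the distribution on $\mathbb R^k$ with density $$f_k(x_1,\dots,x_k\mid\theta)=\sigma^{-k}\exp\Big\{-(1+\xi z_k)^{-1/\xi}-\Big(\tfrac1\xi+1\Big)\sum_{j=1}^k\log(1+\xi z_j)\Big\},\qquad z_j=\frac{x_j-\mu}{\sigma},$$ on the set where $x_1>\dots>x_k$ and $1+\xi z_j>0$ for $j=1,\dots,k$, and density $0$ elsewhere; for $\xi=0$ the expressions $(1+\xi z)^{-1/\xi}$ and $(\tfrac1\xi+1)\log(1+\xi z)$ are read as their limits $e^{-z}$ and $z$. Its log-likelihood is $$l^{(k)}(x_1,\dots,x_k\mid\theta)=-k\log\sigma-(1+\xi z_k)^{-1/\xi}-\Big(\tfrac1\xi+1\Big)\sum_{j=1}^k\log(1+\xi z_j).$$ Let $(X_{i1},\dots,X_{ir})$, $i=1,2,\dots$, be independent random vectors, each with the $\mathrm{GEV}_r(\theta)$ distribution (so that the vectors $(X_{i1},\dots,X_{i,r-1})$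 have the $\mathrm{GEV}_{r-1}(\theta)$ distribution, i.e. the hypothesis $H_0^{(r-1)}$ holds), and put $$Y_{ir}=l^{(r)}(X_{i1},\dots,X_{ir}\mid\theta)-l^{(r-1)}(X_{i1},\dots,X_{i,r-1}\mid\theta).$$ Let $\bar Y_r=\frac1n\sum_{i=1}^nY_{ir}$ and $S_{Y_r}^2=\frac1{n-1}\sum_{i=1}^n(Y_{ir}-\bar Y_r)^2$ be the sample mean and sample variance of $Y_{1r},\dots,Y_{nr}$, and let $\eta_r=-\log\sigma-1+(1+\xi)\psi(r)$, where $\psi(x)=\frac{d}{dx}\log\Gamma(x)$ is the digamma function. Then $$T_n^{(r)}(\theta)=\frac{\sqrt n\,(\bar Y_r-\eta_r)}{S_{Y_r}}$$ converges in distribution to $N(0,1)$ as $n\to\infty$. -/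

import Mathlib

namespace GEVr

open MeasureTheory

/-- The standardized value `z = (x - μ) / σ`. -/
noncomputable def stdz (μ σ x : ℝ) : ℝ := (x - μ) / σ

/-- `(1 + ξ z) ^ (-1 / ξ)`, read as its limit `exp (-z)` when `ξ = 0`. -/
noncomputable def tailTerm (ξ z : ℝ) : ℝ :=
  if ξ = 0 then Real.exp (-z) else (1 + ξ * z) ^ (-(1 / ξ))

/-- `(1 / ξ + 1) * log (1 + ξ z)`, read as its limit `z` when `ξ = 0`. -/
noncomputable def logTerm (ξ z : ℝ) : ℝ :=
  if ξ = 0 then z else (1 / ξ + 1) * Real.log (1 + ξ * z)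

/-- The term `(1 + ξ z_r) ^ (-1 / ξ)` of the last (smallest) coordinate `x_r` of
`x = (x_1, …, x_r)`. There is no such term when `r = 0`. -/
noncomputable def lastTailTerm (μ σ ξ : ℝ) : (r : ℕ) → (Fin r → ℝ) → ℝ
  | 0, _ => 0
  | k + 1, x => tailTerm ξ (stdz μ σ (x (Fin.last k)))

/-- The set `x_1 > ⋯ > x_r`, `1 + ξ z_j > 0` for all `j`, on which the density is positive. -/
def support (μ σ ξ : ℝ) (r : ℕ) : Set (Fin r → ℝ) :=
  {x | StrictAnti x ∧ ∀ j, 0 < 1 + ξ * stdz μ σ (x j)}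

/-- The `GEV_r(μ, σ, ξ)` density on `ℝ^r`. -/
noncomputable def density (μ σ ξ : ℝ) (r : ℕ) : (Fin r → ℝ) → ℝ :=
  (support μ σ ξ r).indicator fun x =>
    (σ ^ r)⁻¹ * Real.exp (-lastTailTerm μ σ ξ r x - ∑ j, logTerm ξ (stdz μ σ (x j)))

/-- The `GEV_r(μ, σ, ξ)` distribution on `ℝ^r`. -/
noncomputable def law (μ σ ξ : ℝ) (r : ℕ) : Measure (Fin r → ℝ) :=
  (volume : Measure (Fin r → ℝ)).withDensity fun x => ENNReal.ofReal (density μ σ ξ r x)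

/-- The `GEV_r` log-likelihood of a single block `(x_1, …, x_r)`. -/
noncomputable def logLik (μ σ ξ : ℝ) (r : ℕ) (x : Fin r → ℝ) : ℝ :=
  -(r * Real.log σ) - lastTailTerm μ σ ξ r x - ∑ j, logTerm ξ (stdz μ σ (x j))

/-- The difference of the `GEV_r` log-likelihood of a block `(x_1, …, x_r)` and the `GEV_{r-1}`
log-likelihood of its `r - 1` largest values `(x_1, …, x_{r-1})`. -/
noncomputable def logLikDiff (μ σ ξ : ℝ) (r : ℕ) (x : Fin r → ℝ) : ℝ :=
  logLik μ σ ξ r x - logLik μ σ ξ (r - 1) fun j => x (Fin.castLE (Nat.sub_le r 1) j)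

/-- The digamma function on the reals, `ψ(x) = d log Γ(x) / dx`. -/
noncomputable def digamma (x : ℝ) : ℝ := deriv (fun t => Real.log (Real.Gamma t)) x

/-- `η_r = -log σ - 1 + (1 + ξ) ψ(r)`. -/
noncomputable def eta (σ ξ : ℝ) (r : ℕ) : ℝ := -Real.log σ - 1 + (1 + ξ) * digamma r

/-- The mean of `y_0, …, y_{n-1}`. -/
noncomputable def sampleMean (n : ℕ) (y : ℕ → ℝ) : ℝ := (∑ i ∈ Finset.range n, y i) / n

/-- The sample variance of `y_0, …, y_{n-1}`, with divisor `n - 1`. -/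
noncomputable def sampleVar (n : ℕ) (y : ℕ → ℝ) : ℝ :=
  (∑ i ∈ Finset.range n, (y i - sampleMean n y) ^ 2) / ((n : ℝ) - 1)

/-- The statistic `T_n^{(r)}(μ, σ, ξ)` computed from the blocks `x_0, …, x_{n-1}`. -/
noncomputable def edStat (μ σ ξ : ℝ) (r n : ℕ) (x : ℕ → Fin r → ℝ) : ℝ :=
  Real.sqrt n * (sampleMean n (fun i => logLikDiff μ σ ξ r (x i)) - eta σ ξ r) /
    Real.sqrt (sampleVar n fun i => logLikDiff μ σ ξ r (x i))

end GEVr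

/-!
Put `w_j = (1 + ξ z_j) ^ (-1 / ξ)` (`arrival`). Since `x ↦ w` is a decreasing bijection of the
admissible interval onto `(0, ∞)` whose derivative is, up to sign, the factor that a coordinate
contributes to the density, the `GEV_r` law becomes the law with density `exp (-w_r)` on
`0 < w_1 < ⋯ < w_r`: the first `r` arrival times of a unit-rate Poisson process. In these terms
`logLikDiff = -log σ - w_r + (1 + ξ) log w_r + w_{r-1}` almost surely (`logLikDiff_ae_eq`).

The coordinates are integrated out one at a time (`lintegral_blockWeight_succ`,
`lintegral_blockWeight`). Hence `w_r` and `w_{r-1}` are Gamma distributed with shapes `r` and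
`r - 1`, which gives a finite second moment, and mean `-log σ - r + (1 + ξ) ψ(r) + (r - 1) = η_r`
because `Γ'(r) = ∫ t ^ (r - 1) log t exp (-t) dt`. The variance is positive since the pair
`(w_{r-1}, w_r)` has an absolutely continuous law (`ae_arrival_ne`), so that `w_{r-1}` is not a
function of `w_r`. The conclusion is then the central limit theorem for studentized means
(`tendstoInDistribution_studentized`), which follows from the central limit theorem, the strong law
of large numbers for the sample variance, and Slutsky's theorem.

Neither the total mass of the law nor the law of the first `r - 1` coordinates has to be computed:
the law is a probability measure because some random vector follows it.
-/

namespace GEVr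

open MeasureTheory ProbabilityTheory Filter Topology Set

/-! ### Studentized means of independent identically distributed variables -/

lemma aemeasurable_sampleMean_comp {Ω : Type*} [MeasurableSpace Ω] {P : Measure Ω}
    {Y : ℕ → Ω → ℝ} (hY : ∀ i, AEMeasurable (Y i) P) (n : ℕ) :
    AEMeasurable (fun ω => sampleMean n fun i => Y i ω) P := by
  unfold sampleMean
  fun_prop

lemma aemeasurable_sampleVar_comp {Ω : Type*} [MeasurableSpace Ω] {P : Measure Ω}
    {Y : ℕ → Ω → ℝ} (hY : ∀ i, AEMeasurable (Y i) P) (n : ℕ) :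
    AEMeasurable (fun ω => sampleVar n fun i => Y i ω) P := by
  unfold sampleVar
  have := aemeasurable_sampleMean_comp hY n
  fun_prop

/-- The divisors `n` and `n - 1` differ by the factor `n / (n - 1) = 1 + 1 / (n - 1)`. -/
lemma sampleVar_eq {n : ℕ} (hn : 2 ≤ n) (y : ℕ → ℝ) :
    sampleVar n y = (1 + 1 / ((n : ℝ) - 1)) *
      ((∑ i ∈ Finset.range n, y i ^ 2) / n - sampleMean n y ^ 2) := by
  have h2 : (2 : ℝ) ≤ n := by exact_mod_cast hn
  have hn0 : (n : ℝ) ≠ 0 := by positivity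
  have hn1 : (n : ℝ) - 1 ≠ 0 := by linarith
  have hs : ∑ i ∈ Finset.range n, y i = n * sampleMean n y := by
    unfold sampleMean; field_simp
  have : ∑ i ∈ Finset.range n, (y i - sampleMean n y) ^ 2
      = ∑ i ∈ Finset.range n, y i ^ 2 - n * sampleMean n y ^ 2 := by
    simp only [sub_sq, Finset.sum_add_distrib, Finset.sum_sub_distrib, ← Finset.sum_mul,
      ← Finset.mul_sum, hs]
    simp only [Finset.sum_const, Finset.card_range, nsmul_eq_mul]
    ring
  rw [sampleVar, this]
  field_simp
  ring

section IID

variable {Ω : Type*} [MeasurableSpace Ω] {P : Measure Ω} [IsProbabilityMeasure P] {Y : ℕ → Ω → ℝ}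

theorem tendsto_sampleVar_ae (hindep : iIndepFun Y P)
    (hident : ∀ i, IdentDistrib (Y i) (Y 0) P P) (hY : MemLp (Y 0) 2 P) :
    ∀ᵐ ω ∂P, Tendsto (fun n => sampleVar n fun i => Y i ω) atTop (𝓝 Var[Y 0; P]) := by
  have h1 := strong_law_ae_real Y (hY.integrable (by norm_num))
    (fun i j hij => hindep.indepFun hij) hident
  have h2 := strong_law_ae_real (fun i ω => Y i ω ^ 2) hY.integrable_sq
    (fun i j hij => (hindep.indepFun hij).comp (φ := fun x : ℝ => x ^ 2) (ψ := fun x : ℝ => x ^ 2)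
      (by fun_prop) (by fun_prop))
    (fun i => (hident i).comp (u := fun x : ℝ => x ^ 2) (by fun_prop))
  filter_upwards [h1, h2] with ω h1 h2
  have h3 : Tendsto (fun n : ℕ => 1 + 1 / ((n : ℝ) - 1)) atTop (𝓝 (1 + 0)) := by
    refine tendsto_const_nhds.add ?_
    simp only [one_div]
    exact tendsto_inv_atTop_zero.comp
      (tendsto_atTop_add_const_right _ (-1) tendsto_natCast_atTop_atTop)
  have h4 := h3.mul (h2.sub (h1.pow 2))
  rw [variance_eq_sub hY]
  simp only [add_zero, one_mul] at h4
  refine h4.congr' ?_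
  filter_upwards [eventually_ge_atTop 2] with n hn
  rw [sampleVar_eq hn, sampleMean]

/-- The central limit theorem for the studentized mean: the central limit theorem for the mean and
Slutsky's theorem with the inverse sample standard deviation, which converges almost surely. -/
theorem tendstoInDistribution_studentized (hindep : iIndepFun Y P)
    (hident : ∀ i, IdentDistrib (Y i) (Y 0) P P) (hY : MemLp (Y 0) 2 P)
    (hvar : Var[Y 0; P] ≠ 0) :
    TendstoInDistribution
      (fun (n : ℕ) ω => Real.sqrt n * (sampleMean n (fun i => Y i ω) - P[Y 0]) /
        Real.sqrt (sampleVar n fun i => Y i ω))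
      atTop (id : ℝ → ℝ) (fun _ => P) (gaussianReal 0 1) := by
  set v := Var[Y 0; P]
  have hv : 0 < v := lt_of_le_of_ne (variance_nonneg _ _) hvar.symm
  have hsv : Real.sqrt v ≠ 0 := (Real.sqrt_pos.2 hv).ne'
  have hZ : HasLaw (fun x : ℝ => Real.sqrt v * x) (gaussianReal 0 v.toNNReal)
      (gaussianReal 0 1) := by
    refine ⟨by fun_prop, ?_⟩
    rw [gaussianReal_map_const_mul]
    congr 1
    · simp
    · ext
      simp [Real.sq_sqrt hv.le, hv.le]
  have hclt := tendstoInDistribution_inv_sqrt_mul_sum_sub hZ hY hindep hident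
  have hmeas i : AEMeasurable (Y i) P := (hident i).aemeasurable_fst
  have hSm (n : ℕ) : AEMeasurable (fun ω => (Real.sqrt (sampleVar n fun i => Y i ω))⁻¹) P :=
    ((aemeasurable_sampleVar_comp hmeas n).sqrt).inv
  have hS : TendstoInMeasure P (fun n ω => (Real.sqrt (sampleVar n fun i => Y i ω))⁻¹) atTop
      (fun _ => (Real.sqrt v)⁻¹) := by
    refine tendstoInMeasure_of_tendsto_ae (fun n => (hSm n).aestronglyMeasurable) ?_
    filter_upwards [tendsto_sampleVar_ae hindep hident hY] with ω hω
    exact (hω.sqrt).inv₀ hsv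
  have := hclt.continuous_comp_prodMk_of_tendstoInMeasure_const
    (g := fun p : ℝ × ℝ => p.1 * p.2) (by fun_prop) hS hSm
  have hlim : (fun x : ℝ => Real.sqrt v * x * (Real.sqrt v)⁻¹) = id := by
    ext x
    field_simp
    rfl
  simp only [hlim] at this
  convert! this using 3 with n ω
  · rw [div_eq_mul_inv]
    congr 1
    rcases Nat.eq_zero_or_pos n with rfl | hn
    -- For `n = 0` both sides vanish because `√0 = 0`.
    · simp
    · have : (0 : ℝ) < n := by exact_mod_cast hn
      have hs := Real.sq_sqrt this.le
      have : Real.sqrt n ≠ 0 := (Real.sqrt_pos.2 this).ne'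
      unfold sampleMean
      field_simp
      rw [hs]

end IID

/-! ### From block coordinates to arrival times -/

/-- The map `x ↦ (1 + ξ z) ^ (-1 / ξ)`, `z = (x - μ) / σ`. It carries the coordinates of a `GEV_r`
vector to the first `r` arrival times of a unit-rate Poisson process. -/
noncomputable def arrival (μ σ ξ x : ℝ) : ℝ := tailTerm ξ (stdz μ σ x)

/-- The factor `exp (-logTerm) / σ` that one coordinate contributes to the density. It is the
absolute value of the derivative of `arrival` on `domain`, which is why the change to arrival times
turns it into Lebesgue measure. -/
noncomputable def arrivalSpeed (μ σ ξ x : ℝ) : ℝ := σ⁻¹ * Real.exp (-logTerm ξ (stdz μ σ x))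

/-- The set `1 + ξ z > 0`, `z = (x - μ) / σ`, of admissible values of one coordinate. -/
def domain (μ σ ξ : ℝ) : Set ℝ := {x | 0 < 1 + ξ * stdz μ σ x}

lemma measurable_stdz (μ σ : ℝ) : Measurable (stdz μ σ) := by
  unfold stdz; fun_prop

lemma measurable_logTerm (ξ : ℝ) : Measurable (logTerm ξ) := by
  unfold logTerm; split_ifs <;> fun_prop

lemma measurable_arrival (μ σ ξ : ℝ) : Measurable (arrival μ σ ξ) := by
  have := measurable_stdz μ σ
  unfold arrival tailTerm; split_ifs <;> fun_prop

lemma measurable_arrivalSpeed (μ σ ξ : ℝ) : Measurable (arrivalSpeed μ σ ξ) := by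
  have := measurable_stdz μ σ
  have := measurable_logTerm ξ
  unfold arrivalSpeed; fun_prop

lemma measurableSet_domain (μ σ ξ : ℝ) : MeasurableSet (domain μ σ ξ) := by
  have := measurable_stdz μ σ
  exact measurableSet_lt measurable_const (by fun_prop)

variable {μ σ ξ : ℝ}

lemma arrivalSpeed_nonneg (hσ : 0 < σ) (x : ℝ) : 0 ≤ arrivalSpeed μ σ ξ x := by
  unfold arrivalSpeed; positivity

lemma arrival_pos {x : ℝ} (hx : x ∈ domain μ σ ξ) : 0 < arrival μ σ ξ x := by
  unfold arrival tailTerm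
  split_ifs
  · positivity
  · exact Real.rpow_pos_of_pos hx _

/-- The powers `-1 / ξ` and `1 / ξ + 1` combine so that each coordinate enters the likelihood only
through `log` of its arrival time, with a coefficient that is regular at `ξ = 0`. -/
lemma logTerm_eq {x : ℝ} (hx : x ∈ domain μ σ ξ) :
    logTerm ξ (stdz μ σ x) = -((1 + ξ) * Real.log (arrival μ σ ξ x)) := by
  unfold arrival tailTerm logTerm
  split_ifs with h
  · simp [h]
  · rw [Real.log_rpow hx]
    field_simp

lemma hasDerivAt_arrival {x : ℝ} (hx : x ∈ domain μ σ ξ) :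
    HasDerivAt (arrival μ σ ξ) (-arrivalSpeed μ σ ξ x) x := by
  have hz : HasDerivAt (stdz μ σ) σ⁻¹ x := by
    have := ((hasDerivAt_id x).sub_const μ).div_const σ
    simpa [stdz, Function.comp_def] using! this
  unfold arrival arrivalSpeed tailTerm logTerm
  split_ifs with h
  · convert! hz.neg.exp using 1
    simp only [Pi.neg_apply]
    ring
  · have h1 : HasDerivAt (fun x => 1 + ξ * stdz μ σ x) (ξ * σ⁻¹) x :=
      (hz.const_mul ξ).const_add 1
    have hx' : 0 < 1 + ξ * stdz μ σ x := hx
    convert! h1.rpow_const (p := -(1 / ξ)) (Or.inl hx'.ne') using 1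
    rw [Real.rpow_def_of_pos hx']
    have : -((1 / ξ + 1) * Real.log (1 + ξ * stdz μ σ x))
      = Real.log (1 + ξ * stdz μ σ x) * (-(1 / ξ) - 1) := by ring
    rw [this]
    field_simp

lemma strictAntiOn_arrival (hσ : 0 < σ) : StrictAntiOn (arrival μ σ ξ) (domain μ σ ξ) := by
  intro x hx y hy hxy
  have hz : stdz μ σ x < stdz μ σ y := by
    unfold stdz; gcongr
  unfold arrival tailTerm
  split_ifs with h
  · gcongr
  · rcases lt_or_gt_of_ne h with h | h
    · refine Real.rpow_lt_rpow (le_of_lt hy) ?_ (by simpa using h)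
      nlinarith
    · refine Real.rpow_lt_rpow_of_neg hx ?_ (by simpa using h)
      nlinarith

lemma image_arrival (hσ : 0 < σ) : arrival μ σ ξ '' domain μ σ ξ = Ioi 0 := by
  apply Subset.antisymm
  · rintro _ ⟨x, hx, rfl⟩
    exact arrival_pos hx
  · intro w (hw : 0 < w)
    by_cases h : ξ = 0
    · refine ⟨μ + σ * (-Real.log w), ?_, ?_⟩
      · simp [domain, h]
      · have : stdz μ σ (μ + σ * (-Real.log w)) = -Real.log w := by
          unfold stdz; field_simp; ring
        simp only [arrival, this, tailTerm, h, if_true, neg_neg, Real.exp_log hw]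
    · have key : 1 + ξ * stdz μ σ (μ + σ * ((w ^ (-ξ) - 1) / ξ)) = w ^ (-ξ) := by
        unfold stdz; field_simp; ring
      refine ⟨μ + σ * ((w ^ (-ξ) - 1) / ξ), ?_, ?_⟩
      · simp only [domain, mem_ofPred_eq, key]
        positivity
      · simp only [arrival, tailTerm, h, if_false, key]
        rw [← Real.rpow_mul hw.le]
        have : -ξ * -(1 / ξ) = 1 := by field_simp
        rw [this, Real.rpow_one]

/-- The substitution `w = arrival y` on the part of the domain below `x`. -/
lemma lintegral_domain_inter_Iio (hσ : 0 < σ) {x : ℝ} (hx : x ∈ domain μ σ ξ) (g : ℝ → ENNReal) :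
    ∫⁻ y in domain μ σ ξ ∩ Iio x, ENNReal.ofReal (arrivalSpeed μ σ ξ y) * g (arrival μ σ ξ y)
      = ∫⁻ w in Ioi (arrival μ σ ξ x), g w := by
  have himg : arrival μ σ ξ '' (domain μ σ ξ ∩ Iio x) = Ioi (arrival μ σ ξ x) := by
    apply Subset.antisymm
    · rintro _ ⟨y, ⟨hy, hyx⟩, rfl⟩
      exact strictAntiOn_arrival hσ hy hx hyx
    · intro w (hw : _ < w)
      have : w ∈ arrival μ σ ξ '' domain μ σ ξ := by
        rw [image_arrival hσ]; exact (arrival_pos hx).trans hw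
      obtain ⟨y, hy, rfl⟩ := this
      exact ⟨y, ⟨hy, ((strictAntiOn_arrival hσ).lt_iff_gt hx hy).1 hw⟩, rfl⟩
  rw [← himg, lintegral_image_eq_lintegral_abs_deriv_mul
    ((measurableSet_domain μ σ ξ).inter measurableSet_Iio)
    (fun y hy => (hasDerivAt_arrival hy.1).hasDerivWithinAt)
    ((strictAntiOn_arrival hσ).injOn.mono inter_subset_left)]
  simp [abs_of_nonneg (arrivalSpeed_nonneg hσ _)]

/-- The substitution `w = arrival y` on the whole domain. -/
lemma lintegral_domain (hσ : 0 < σ) (g : ℝ → ENNReal) :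
    ∫⁻ y in domain μ σ ξ, ENNReal.ofReal (arrivalSpeed μ σ ξ y) * g (arrival μ σ ξ y)
      = ∫⁻ w in Ioi 0, g w := by
  rw [← image_arrival (μ := μ) (ξ := ξ) hσ, lintegral_image_eq_lintegral_abs_deriv_mul
    (measurableSet_domain μ σ ξ)
    (fun y hy => (hasDerivAt_arrival hy).hasDerivWithinAt)
    (strictAntiOn_arrival hσ).injOn]
  simp [abs_of_nonneg (arrivalSpeed_nonneg hσ _)]

/-! ### Integrating out coordinates of a block -/

/-- The `GEV_r` density without its factor `exp (-w_r)`. After the change to the arrival times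
`w_j` it becomes Lebesgue measure on `0 < w_1 < ⋯ < w_r`. -/
noncomputable def blockWeight (μ σ ξ : ℝ) (r : ℕ) : (Fin r → ℝ) → ENNReal :=
  (support μ σ ξ r).indicator fun x => ∏ j, ENNReal.ofReal (arrivalSpeed μ σ ξ (x j))

lemma measurableSet_support (μ σ ξ : ℝ) (r : ℕ) : MeasurableSet (support μ σ ξ r) := by
  have h : support μ σ ξ r = (⋂ i, ⋂ j, ⋂ (_ : i < j), {x : Fin r → ℝ | x j < x i}) ∩
      ⋂ j, (fun x : Fin r → ℝ => x j) ⁻¹' domain μ σ ξ := by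
    ext x
    simp only [support, StrictAnti, mem_ofPred_eq, mem_inter_iff, mem_iInter, mem_preimage, domain]
  rw [h]
  refine MeasurableSet.inter ?_ ?_
  · exact .iInter fun i => .iInter fun j => .iInter fun _ =>
      measurableSet_lt (measurable_pi_apply j) (measurable_pi_apply i)
  · exact .iInter fun j => measurable_pi_apply j (measurableSet_domain μ σ ξ)

lemma measurable_blockWeight (μ σ ξ : ℝ) (r : ℕ) : Measurable (blockWeight μ σ ξ r) := by
  have := measurable_arrivalSpeed μ σ ξ
  refine Measurable.indicator ?_ (measurableSet_support μ σ ξ r)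
  fun_prop

lemma mem_support_insertNth_last {k : ℕ} (y : ℝ) (x : Fin (k + 1) → ℝ) :
    (Fin.last (k + 1)).insertNth (α := fun _ => ℝ) y x ∈ support μ σ ξ (k + 2) ↔
      x ∈ support μ σ ξ (k + 1) ∧ y ∈ domain μ σ ξ ∩ Iio (x (Fin.last k)) := by
  simp only [support, mem_ofPred_eq, Fin.insertNth_last', Fin.strictAnti_iff_succ_lt, domain,
    mem_inter_iff, mem_Iio]
  rw [Fin.forall_fin_succ' (n := k), Fin.forall_fin_succ' (n := k + 1)]
  simp only [← Fin.castSucc_succ, Fin.succ_last, Fin.snoc_castSucc, Fin.snoc_last]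
  tauto

lemma blockWeight_insertNth_last {k : ℕ} (y : ℝ) (x : Fin (k + 1) → ℝ) :
    blockWeight μ σ ξ (k + 2) ((Fin.last (k + 1)).insertNth (α := fun _ => ℝ) y x) =
      blockWeight μ σ ξ (k + 1) x * (domain μ σ ξ ∩ Iio (x (Fin.last k))).indicator
        (fun y => ENNReal.ofReal (arrivalSpeed μ σ ξ y)) y := by
  classical
  unfold blockWeight
  simp only [indicator_apply, mem_support_insertNth_last]
  by_cases h1 : x ∈ support μ σ ξ (k + 1) <;>
  by_cases h2 : y ∈ domain μ σ ξ ∩ Iio (x (Fin.last k))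
  · simp only [h1, h2, and_self, if_true]
    rw [Fin.prod_univ_castSucc]
    simp only [Fin.insertNth_last', Fin.snoc_castSucc, Fin.snoc_last]
  all_goals simp [h1, h2]

/-- Integrating out the last coordinate of a block. -/
lemma lintegral_blockWeight_succ (hσ : 0 < σ) (k : ℕ) {H : ℝ × ℝ → ENNReal} (hH : Measurable H) :
    ∫⁻ x : Fin (k + 2) → ℝ, blockWeight μ σ ξ (k + 2) x *
        H (arrival μ σ ξ (x (Fin.last k).castSucc), arrival μ σ ξ (x (Fin.last (k + 1)))) =
      ∫⁻ x : Fin (k + 1) → ℝ, blockWeight μ σ ξ (k + 1) x *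
        ∫⁻ w in Ioi (arrival μ σ ξ (x (Fin.last k))), H (arrival μ σ ξ (x (Fin.last k)), w) := by
  have hV := measurable_arrival μ σ ξ
  have hB := measurable_blockWeight μ σ ξ (k + 2)
  have hmp := (volume_preserving_piFinSuccAbove (fun _ : Fin (k + 2) => ℝ) (Fin.last (k + 1))).symm
  rw [← hmp.lintegral_comp (by fun_prop), Measure.volume_eq_prod, lintegral_prod_symm]
  swap
  · refine Measurable.aemeasurable ?_
    refine Measurable.comp (g := fun x : Fin (k + 2) → ℝ => blockWeight μ σ ξ (k + 2) x *
      H (arrival μ σ ξ (x (Fin.last k).castSucc), arrival μ σ ξ (x (Fin.last (k + 1)))))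
      (by fun_prop) (MeasurableEquiv.measurable _)
  refine lintegral_congr fun x => ?_
  have hy (y : ℝ) := blockWeight_insertNth_last (μ := μ) (σ := σ) (ξ := ξ) y x
  simp only [MeasurableEquiv.piFinSuccAbove_symm_apply, Fin.insertNthEquiv, Equiv.coe_fn_mk, hy]
  simp only [Fin.insertNth_last', Fin.snoc_castSucc, Fin.snoc_last, mul_assoc]
  rw [lintegral_const_mul']
  swap
  · classical
    unfold blockWeight
    rw [indicator_apply]
    split_ifs
    · exact ENNReal.prod_ne_top fun _ _ => ENNReal.ofReal_ne_top
    · simp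
  by_cases hx : x ∈ support μ σ ξ (k + 1)
  · congr 1
    rw [← lintegral_domain_inter_Iio hσ (hx.2 (Fin.last k)), ← lintegral_indicator
      ((measurableSet_domain μ σ ξ).inter measurableSet_Iio)]
    refine lintegral_congr fun y => ?_
    by_cases hy : y ∈ domain μ σ ξ ∩ Iio (x (Fin.last k))
    · simp only [indicator_of_mem hy]
    · simp only [indicator_of_notMem hy, zero_mul]
  · simp [blockWeight, hx]

/-- The last arrival time: integrating out the `k` earlier ones leaves the volume `s ^ k / k!` of
`0 < w_1 < ⋯ < w_k < s`. -/
lemma lintegral_blockWeight (hσ : 0 < σ) (k : ℕ) {h : ℝ → ENNReal} (hh : Measurable h) :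
    ∫⁻ x : Fin (k + 1) → ℝ, blockWeight μ σ ξ (k + 1) x * h (arrival μ σ ξ (x (Fin.last k))) =
      ∫⁻ s in Ioi 0, ENNReal.ofReal (s ^ k / k.factorial) * h s := by
  induction k generalizing h with
  | zero =>
    have hmp : MeasurePreserving (MeasurableEquiv.funUnique (Fin 1) ℝ).symm volume
        (volume : Measure (Fin 1 → ℝ)) := (volume_preserving_funUnique (Fin 1) ℝ).symm
    change ∫⁻ x : Fin 1 → ℝ, blockWeight μ σ ξ 1 x * h (arrival μ σ ξ (x 0)) = _
    rw [← hmp.lintegral_comp_emb (MeasurableEquiv.measurableEmbedding _)]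
    simp only [pow_zero, Nat.factorial_zero, Nat.cast_one, div_one, ENNReal.ofReal_one, one_mul]
    rw [← lintegral_domain (μ := μ) (ξ := ξ) hσ, ← lintegral_indicator (measurableSet_domain μ σ ξ)]
    refine lintegral_congr fun y => ?_
    have hy : (MeasurableEquiv.funUnique (Fin 1) ℝ).symm y = fun _ => y := by
      ext; rfl
    have : (fun _ : Fin 1 => y) ∈ support μ σ ξ 1 ↔ y ∈ domain μ σ ξ := by
      simp [support, domain, Subsingleton.strictAnti]
    rw [hy]
    by_cases hyd : y ∈ domain μ σ ξ
    · simp [blockWeight, this, hyd]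
    · simp [blockWeight, this, hyd]
  | succ k ih =>
    rw [lintegral_blockWeight_succ hσ k (H := fun p => h p.2) (by fun_prop)]
    have hmeas : Measurable fun p : ℝ × ℝ => (Ioi p.1).indicator h p.2 := by
      have : (fun p : ℝ × ℝ => (Ioi p.1).indicator h p.2)
          = {p : ℝ × ℝ | p.1 < p.2}.indicator fun p => h p.2 := by
        ext p; simp [indicator_apply]
      rw [this]
      exact Measurable.indicator (by fun_prop) (measurableSet_lt measurable_fst measurable_snd)
    have hi : Measurable fun s => ∫⁻ w in Ioi s, h w := by
      simp_rw [← lintegral_indicator measurableSet_Ioi]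
      exact hmeas.lintegral_prod_right'
    rw [ih hi]
    simp_rw [← lintegral_indicator measurableSet_Ioi]
    have : ∀ s : ℝ, (Ioi 0).indicator (fun s => ENNReal.ofReal (s ^ k / k.factorial) *
        ∫⁻ w, (Ioi s).indicator h w) s = ∫⁻ w, (Ioi 0).indicator
          (fun s => ENNReal.ofReal (s ^ k / k.factorial)) s * (Ioi s).indicator h w := by
      intro s
      rw [lintegral_const_mul _ (hh.indicator measurableSet_Ioi)]
      simp only [indicator_apply]
      split_ifs <;> simp
    simp_rw [this]
    rw [lintegral_lintegral_swap]
    swap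
    · refine Measurable.aemeasurable ?_
      refine Measurable.mul ?_ hmeas
      exact (Measurable.indicator (by fun_prop) measurableSet_Ioi).comp measurable_fst
    refine lintegral_congr fun w => ?_
    have h1 : ∀ s, (Ioi 0).indicator (fun s => ENNReal.ofReal (s ^ k / k.factorial)) s *
        (Ioi s).indicator h w = (Ioo 0 w).indicator
          (fun s => ENNReal.ofReal (s ^ k / k.factorial)) s * h w := by
      intro s
      simp only [indicator_apply, mem_Ioi, mem_Ioo]
      split_ifs <;> simp_all
    simp_rw [h1]
    rw [lintegral_mul_const _ (Measurable.indicator (by fun_prop) measurableSet_Ioo),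
      lintegral_indicator measurableSet_Ioo]
    simp only [indicator_apply, mem_Ioi]
    split_ifs with hw
    · congr 1
      rw [← ofReal_integral_eq_lintegral_ofReal]
      · rw [← integral_Ioc_eq_integral_Ioo, ← intervalIntegral.integral_of_le hw.le,
          intervalIntegral.integral_div, integral_pow]
        congr 1
        rw [Nat.factorial_succ]
        push_cast
        simp only [ne_eq, Nat.add_eq_zero_iff, one_ne_zero, and_false, not_false_eq_true, zero_pow,
          sub_zero]
        field_simp
      · have : IntegrableOn (fun s : ℝ => s ^ k / k.factorial) (Icc 0 w) :=
          (by fun_prop : Continuous fun s : ℝ => s ^ k / k.factorial).continuousOn.integrableOn_Icc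
        exact this.mono_set Ioo_subset_Icc_self
      · filter_upwards [ae_restrict_mem measurableSet_Ioo] with s hs
        have := hs.1.le
        positivity
    · simp [Ioo_eq_empty hw]

/-! ### Moments of the Erlang distribution -/

/-- The Erlang distribution with density `t ^ k * exp (-t) / k!` on `t > 0`, i.e. the Gamma
distribution of shape `k + 1`: the law of the arrival time number `k + 1`. -/
noncomputable def erlang (k : ℕ) : Measure ℝ :=
  (volume.restrict (Ioi 0)).withDensity fun t =>
    ENNReal.ofReal (t ^ k / k.factorial * Real.exp (-t))

lemma lintegral_erlang (k : ℕ) {h : ℝ → ENNReal} (hh : Measurable h) :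
    ∫⁻ t, h t ∂erlang k = ∫⁻ t in Ioi 0, ENNReal.ofReal (t ^ k / k.factorial) *
      (ENNReal.ofReal (Real.exp (-t)) * h t) := by
  rw [erlang, lintegral_withDensity_eq_lintegral_mul _ (by fun_prop) hh]
  refine setLIntegral_congr_fun measurableSet_Ioi fun t (ht : 0 < t) => ?_
  simp only [Pi.mul_apply]
  rw [ENNReal.ofReal_mul (by positivity), mul_assoc]

lemma integrable_erlang_iff (k : ℕ) (g : ℝ → ℝ) :
    Integrable g (erlang k) ↔
      IntegrableOn (fun t => t ^ k / k.factorial * Real.exp (-t) * g t) (Ioi 0) := by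
  rw [erlang, integrable_withDensity_iff_integrable_smul' (by fun_prop) (by simp), IntegrableOn]
  refine integrable_congr ?_
  filter_upwards [ae_restrict_mem measurableSet_Ioi] with t (ht : 0 < t)
  rw [ENNReal.toReal_ofReal (by positivity), smul_eq_mul]

lemma integral_erlang (k : ℕ) (g : ℝ → ℝ) :
    ∫ t, g t ∂erlang k = ∫ t in Ioi 0, t ^ k / k.factorial * Real.exp (-t) * g t := by
  rw [erlang, integral_withDensity_eq_integral_toReal_smul (by fun_prop) (by simp)]
  refine setIntegral_congr_fun measurableSet_Ioi fun t (ht : 0 < t) => ?_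
  rw [ENNReal.toReal_ofReal (by positivity), smul_eq_mul]

lemma integrableOn_pow_mul_exp_neg (n : ℕ) :
    IntegrableOn (fun t : ℝ => t ^ n * Real.exp (-t)) (Ioi 0) := by
  have := Real.GammaIntegral_convergent (s := n + 1) (by positivity)
  simpa [mul_comm] using this

lemma integral_pow_mul_exp_neg (n : ℕ) :
    ∫ t : ℝ in Ioi 0, t ^ n * Real.exp (-t) = n.factorial := by
  rw [← Real.Gamma_nat_eq_factorial, Real.Gamma_eq_integral (by positivity)]
  simp [mul_comm]

lemma memLp_id_erlang (k : ℕ) : MemLp (fun t : ℝ => t) 2 (erlang k) := by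
  rw [memLp_two_iff_integrable_sq (by fun_prop), integrable_erlang_iff]
  refine ((integrableOn_pow_mul_exp_neg (k + 2)).div_const (k.factorial : ℝ)).congr
    (ae_of_all _ fun t => ?_)
  simp only
  ring

lemma integral_id_erlang (k : ℕ) : ∫ t, t ∂erlang k = k + 1 := by
  rw [integral_erlang]
  have : ∀ t : ℝ, t ^ k / k.factorial * Real.exp (-t) * t
      = (t ^ (k + 1) * Real.exp (-t)) / k.factorial := fun t => by ring
  simp_rw [this]
  rw [integral_div, integral_pow_mul_exp_neg, Nat.factorial_succ]
  push_cast
  field_simp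

/-- Controls `log ^ 2` at `0` and at `∞` at once, by functions integrable against `erlang (k + 1)`. -/
lemma sq_log_le {t : ℝ} (ht : 0 < t) : Real.log t ^ 2 ≤ 4 * (t + t⁻¹) := by
  have hs : 0 < Real.sqrt t := Real.sqrt_pos.2 ht
  have hsq := Real.sq_sqrt ht.le
  -- `log s ≤ s` is applied to `s = √t` and to `s = 1 / √t`.
  have h1 : Real.log t = 2 * Real.log (Real.sqrt t) := by
    rw [Real.log_sqrt ht.le]; ring
  have h2 : Real.log (Real.sqrt t) ≤ Real.sqrt t :=
    (Real.log_le_sub_one_of_pos hs).trans (by linarith)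
  have h3 : -Real.log (Real.sqrt t) ≤ (Real.sqrt t)⁻¹ := by
    rw [← Real.log_inv]
    exact (Real.log_le_sub_one_of_pos (by positivity)).trans (by linarith)
  have h4 : Real.log (Real.sqrt t) ^ 2 ≤ t + t⁻¹ := by
    have hinv : t⁻¹ = (Real.sqrt t)⁻¹ ^ 2 := by rw [inv_pow, hsq]
    rw [hinv]
    rcases le_total 0 (Real.log (Real.sqrt t)) with h | h
    · have := pow_le_pow_left₀ h h2 2
      have : 0 ≤ (Real.sqrt t)⁻¹ ^ 2 := by positivity
      linarith
    · have := pow_le_pow_left₀ (neg_nonneg.2 h) h3 2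
      linarith [neg_sq (Real.log (Real.sqrt t))]
  rw [h1, mul_pow]
  linarith

/-- The shape is at least `2`, so that the density cancels the factor `t⁻¹` of `sq_log_le`. -/
lemma memLp_log_erlang (k : ℕ) : MemLp Real.log 2 (erlang (k + 1)) := by
  rw [memLp_two_iff_integrable_sq (by fun_prop), integrable_erlang_iff]
  have hb := ((((integrableOn_pow_mul_exp_neg (k + 2)).add
    (integrableOn_pow_mul_exp_neg k)).const_mul 4).div_const ((k + 1).factorial : ℝ))
  refine Integrable.mono' hb (by fun_prop) ?_
  filter_upwards [ae_restrict_mem measurableSet_Ioi] with t (ht : 0 < t)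
  rw [Real.norm_of_nonneg (by positivity)]
  calc t ^ (k + 1) / ((k + 1).factorial : ℝ) * Real.exp (-t) * Real.log t ^ 2
      ≤ t ^ (k + 1) / ((k + 1).factorial : ℝ) * Real.exp (-t) * (4 * (t + t⁻¹)) := by
        gcongr
        exact sq_log_le ht
    _ = _ := by
        simp only [Pi.add_apply]
        field_simp
        ring

/-- Differentiation of the Gamma integral under the integral sign, on the positive reals. -/
lemma hasDerivAt_Gamma {s : ℝ} (hs : 0 < s) :
    HasDerivAt Real.Gamma
      (∫ t in Ioi (0 : ℝ), t ^ (s - 1) * (Real.log t * Real.exp (-t))) s := by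
  have h : HasDerivAt Complex.Gamma _ (s : ℂ) :=
    (Complex.hasDerivAt_GammaIntegral (s := (s : ℂ)) (by simpa using hs)).congr_of_eventuallyEq <| by
      have : {z : ℂ | 0 < z.re} ∈ 𝓝 (s : ℂ) :=
        (isOpen_lt continuous_const Complex.continuous_re).mem_nhds (by simpa using hs)
      filter_upwards [this] with z hz using Complex.Gamma_eq_integral hz
  have h2 := h.real_of_complex
  simp only [Complex.Gamma_ofReal, Complex.ofReal_re] at h2
  convert! h2 using 1
  rw [← Complex.ofReal_re (∫ t in Ioi (0 : ℝ), t ^ (s - 1) * (Real.log t * Real.exp (-t))),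
    ← integral_complex_ofReal]
  congr 1
  refine setIntegral_congr_fun measurableSet_Ioi fun t (ht : 0 < t) => ?_
  simp only [Complex.ofReal_mul, Complex.ofReal_cpow ht.le, Complex.ofReal_sub, Complex.ofReal_one,
    Complex.ofReal_exp, Complex.ofReal_neg]

/-- This is where the digamma function enters: `Γ' (k + 1) / Γ (k + 1)` is the mean of `log`. -/
lemma integral_log_erlang (k : ℕ) : ∫ t, Real.log t ∂erlang k = digamma (k + 1) := by
  have hk : (0 : ℝ) < k + 1 := by positivity
  rw [digamma, ((hasDerivAt_Gamma hk).log (Real.Gamma_pos_of_pos hk).ne').deriv,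
    Real.Gamma_nat_eq_factorial, integral_erlang, ← integral_div]
  refine setIntegral_congr_fun measurableSet_Ioi fun t (ht : 0 < t) => ?_
  simp only [add_sub_cancel_right, Real.rpow_natCast]
  ring

/-! ### Laws of the last two arrival times -/

lemma ofReal_density (hσ : 0 < σ) (k : ℕ) (x : Fin (k + 1) → ℝ) :
    ENNReal.ofReal (density μ σ ξ (k + 1) x) =
      blockWeight μ σ ξ (k + 1) x * ENNReal.ofReal (Real.exp (-arrival μ σ ξ (x (Fin.last k)))) := by
  by_cases hx : x ∈ support μ σ ξ (k + 1)
  · simp only [density, blockWeight, indicator_of_mem hx, lastTailTerm]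
    rw [← ENNReal.ofReal_prod_of_nonneg fun _ _ => arrivalSpeed_nonneg hσ _,
      ← ENNReal.ofReal_mul (Finset.prod_nonneg fun _ _ => arrivalSpeed_nonneg hσ _)]
    congr 1
    simp only [arrivalSpeed, Finset.prod_mul_distrib, Finset.prod_const, Finset.card_univ,
      Fintype.card_fin, ← Real.exp_sum, Finset.sum_neg_distrib, inv_pow, mul_assoc,
      ← Real.exp_add, arrival]
    ring_nf
  · simp [density, blockWeight, hx]

lemma measurable_ofReal_density (hσ : 0 < σ) (k : ℕ) :
    Measurable fun x => ENNReal.ofReal (density μ σ ξ (k + 1) x) := by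
  have := measurable_arrival μ σ ξ
  have := measurable_blockWeight μ σ ξ (k + 1)
  simp_rw [ofReal_density hσ]
  fun_prop

lemma lintegral_law (hσ : 0 < σ) (k : ℕ) {h : (Fin (k + 1) → ℝ) → ENNReal} (hh : Measurable h) :
    ∫⁻ x, h x ∂law μ σ ξ (k + 1) = ∫⁻ x, blockWeight μ σ ξ (k + 1) x *
      (ENNReal.ofReal (Real.exp (-arrival μ σ ξ (x (Fin.last k)))) * h x) := by
  rw [law, lintegral_withDensity_eq_lintegral_mul _ (measurable_ofReal_density hσ k) hh]
  simp only [Pi.mul_apply, ofReal_density hσ, mul_assoc]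

lemma ae_mem_support (μ σ ξ : ℝ) (r : ℕ) : ∀ᵐ x ∂law μ σ ξ r, x ∈ support μ σ ξ r := by
  rw [law, ae_iff]
  change (volume.withDensity _) (support μ σ ξ r)ᶜ = 0
  rw [withDensity_apply _ (measurableSet_support μ σ ξ r).compl,
    setLIntegral_congr_fun (g := fun _ => 0) (measurableSet_support μ σ ξ r).compl]
  · simp
  · intro x hx
    simp [density, indicator_of_notMem hx]

/-- The last arrival time of a block is Erlang distributed. -/
lemma hasLaw_arrival_last (hσ : 0 < σ) (k : ℕ) :
    HasLaw (fun x : Fin (k + 1) → ℝ => arrival μ σ ξ (x (Fin.last k))) (erlang k)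
      (law μ σ ξ (k + 1)) := by
  have hV := measurable_arrival μ σ ξ
  refine ⟨(by fun_prop : Measurable _).aemeasurable, Measure.ext_of_lintegral _ fun h hh => ?_⟩
  rw [lintegral_map hh (by fun_prop), lintegral_law hσ k (by fun_prop), lintegral_erlang k hh]
  exact lintegral_blockWeight hσ k
    (h := fun s => ENNReal.ofReal (Real.exp (-s)) * h s) (by fun_prop)

lemma lintegral_exp_neg_Ioi (s : ℝ) :
    ∫⁻ w in Ioi s, ENNReal.ofReal (Real.exp (-w)) = ENNReal.ofReal (Real.exp (-s)) := by
  rw [← ofReal_integral_eq_lintegral_ofReal, integral_exp_neg_Ioi]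
  · exact integrableOn_exp_neg_Ioi s
  · exact ae_of_all _ fun _ => (Real.exp_pos _).le

/-- The last but one arrival time of a block is Erlang distributed. -/
lemma hasLaw_arrival_castSucc_last (hσ : 0 < σ) (k : ℕ) :
    HasLaw (fun x : Fin (k + 2) → ℝ => arrival μ σ ξ (x (Fin.last k).castSucc)) (erlang k)
      (law μ σ ξ (k + 2)) := by
  have hV := measurable_arrival μ σ ξ
  refine ⟨(by fun_prop : Measurable _).aemeasurable, Measure.ext_of_lintegral _ fun h hh => ?_⟩
  rw [lintegral_map hh (by fun_prop), lintegral_law hσ (k + 1) (by fun_prop), lintegral_erlang k hh,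
    lintegral_blockWeight_succ hσ k (H := fun p => ENNReal.ofReal (Real.exp (-p.2)) * h p.1)
      (by fun_prop)]
  simp_rw [lintegral_mul_const _ (by fun_prop : Measurable fun w => ENNReal.ofReal (Real.exp (-w))),
    lintegral_exp_neg_Ioi]
  exact lintegral_blockWeight hσ k
    (h := fun s => ENNReal.ofReal (Real.exp (-s)) * h s) (by fun_prop)

/-- The last two arrival times have an absolutely continuous joint law, so they almost surely do
not lie on the graph of a given function. -/
lemma ae_arrival_ne (hσ : 0 < σ) (k : ℕ) {φ : ℝ → ℝ} (hφ : Measurable φ) :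
    ∀ᵐ x ∂law μ σ ξ (k + 2), arrival μ σ ξ (x (Fin.last k).castSucc) ≠
      φ (arrival μ σ ξ (x (Fin.last (k + 1)))) := by
  have hV := measurable_arrival μ σ ξ
  set G : Set (ℝ × ℝ) := {p | p.1 = φ p.2}
  have hG : MeasurableSet G := measurableSet_eq_fun (by fun_prop) (by fun_prop)
  have hG0 : (volume.prod volume) G = 0 := by
    rw [Measure.prod_apply_symm hG, lintegral_eq_zero_iff (measurable_measure_prodMk_right hG)]
    refine ae_of_all _ fun w => ?_
    have : (fun s => (s, w)) ⁻¹' G = {φ w} := by ext s; simp [G]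
    simp [this]
  rw [Measure.measure_prod_null hG] at hG0
  have hmeas : Measurable fun x : Fin (k + 2) → ℝ =>
      (arrival μ σ ξ (x (Fin.last k).castSucc), arrival μ σ ξ (x (Fin.last (k + 1)))) := by fun_prop
  rw [ae_iff]
  simp only [ne_eq, not_not]
  change law μ σ ξ (k + 2) ((fun x : Fin (k + 2) → ℝ => (arrival μ σ ξ (x (Fin.last k).castSucc),
    arrival μ σ ξ (x (Fin.last (k + 1))))) ⁻¹' G) = 0
  rw [← lintegral_indicator_one (hmeas hG), lintegral_law hσ (k + 1)
    (measurable_one.indicator (hmeas hG))]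
  have := lintegral_blockWeight_succ (μ := μ) (ξ := ξ) hσ k
    (H := fun p => ENNReal.ofReal (Real.exp (-p.2)) * G.indicator 1 p)
    (Measurable.mul (by fun_prop) (measurable_one.indicator hG))
  refine this.trans ?_
  have hm : Measurable fun p : ℝ × ℝ => (Ioi p.1).indicator
      (fun w => ENNReal.ofReal (Real.exp (-w)) * G.indicator 1 (p.1, w)) p.2 := by
    have : (fun p : ℝ × ℝ => (Ioi p.1).indicator
        (fun w => ENNReal.ofReal (Real.exp (-w)) * G.indicator 1 (p.1, w)) p.2)
        = {p : ℝ × ℝ | p.1 < p.2}.indicator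
          fun p => ENNReal.ofReal (Real.exp (-p.2)) * G.indicator 1 p := by
      ext p; simp [indicator_apply]
    rw [this]
    exact Measurable.indicator (Measurable.mul (by fun_prop) (measurable_one.indicator hG))
      (measurableSet_lt measurable_fst measurable_snd)
  have hi : Measurable fun s => ∫⁻ w in Ioi s,
      ENNReal.ofReal (Real.exp (-w)) * G.indicator 1 (s, w) := by
    simp_rw [← lintegral_indicator measurableSet_Ioi]
    exact hm.lintegral_prod_right'
  rw [lintegral_blockWeight hσ k hi]
  refine (lintegral_congr_ae (g := fun _ => 0) ?_).trans lintegral_zero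
  filter_upwards [ae_restrict_of_ae hG0] with s hs
  have : ∫⁻ w in Ioi s, ENNReal.ofReal (Real.exp (-w)) * G.indicator 1 (s, w) = 0 := by
    refine (lintegral_congr_ae (g := fun _ => 0) ?_).trans lintegral_zero
    have hs' : ∀ᵐ w : ℝ, w ∉ Prod.mk s ⁻¹' G := measure_eq_zero_iff_ae_notMem.1 hs
    filter_upwards [ae_restrict_of_ae hs'] with w hw
    have hw' : (s, w) ∉ G := hw
    simp [hw']
  rw [this, mul_zero]

/-! ### The log-likelihood difference -/

lemma logLikDiff_eq {k : ℕ} {x : Fin (k + 2) → ℝ} (hx : x ∈ support μ σ ξ (k + 2)) :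
    logLikDiff μ σ ξ (k + 2) x = -Real.log σ - arrival μ σ ξ (x (Fin.last (k + 1))) +
      (1 + ξ) * Real.log (arrival μ σ ξ (x (Fin.last (k + 1)))) +
      arrival μ σ ξ (x (Fin.last k).castSucc) := by
  have h1 : logLikDiff μ σ ξ (k + 2) x = logLik μ σ ξ (k + 2) x -
    logLik μ σ ξ (k + 1) fun j => x j.castSucc := rfl
  rw [h1]
  simp only [logLik, lastTailTerm, Fin.sum_univ_castSucc (n := k + 1)]
  rw [logTerm_eq (hx.2 (Fin.last (k + 1)))]
  simp only [arrival]
  push_cast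
  ring

lemma measurable_logLik (μ σ ξ : ℝ) (r : ℕ) : Measurable (logLik μ σ ξ r) := by
  have := measurable_logTerm ξ
  have := measurable_stdz μ σ
  have hV := measurable_arrival μ σ ξ
  have : Measurable (lastTailTerm μ σ ξ r) := by
    cases r with
    | zero => exact measurable_const
    | succ k => exact hV.comp (measurable_pi_apply (Fin.last k))
  unfold logLik
  fun_prop

lemma measurable_logLikDiff (μ σ ξ : ℝ) (r : ℕ) : Measurable (logLikDiff μ σ ξ r) := by
  have := measurable_logLik μ σ ξ r
  have := measurable_logLik μ σ ξ (r - 1)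
  unfold logLikDiff
  fun_prop

lemma logLikDiff_ae_eq (μ σ ξ : ℝ) (k : ℕ) :
    logLikDiff μ σ ξ (k + 2) =ᵐ[law μ σ ξ (k + 2)] fun x =>
      -Real.log σ - arrival μ σ ξ (x (Fin.last (k + 1))) +
      (1 + ξ) * Real.log (arrival μ σ ξ (x (Fin.last (k + 1)))) +
      arrival μ σ ξ (x (Fin.last k).castSucc) := by
  filter_upwards [ae_mem_support μ σ ξ (k + 2)] with x hx using logLikDiff_eq hx

lemma measurePreserving_arrival_last (hσ : 0 < σ) (k : ℕ) :
    MeasurePreserving (fun x : Fin (k + 1) → ℝ => arrival μ σ ξ (x (Fin.last k)))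
      (law μ σ ξ (k + 1)) (erlang k) :=
  (hasLaw_arrival_last hσ k).measurePreserving
    ((measurable_arrival μ σ ξ).comp (measurable_pi_apply _))

lemma measurePreserving_arrival_castSucc_last (hσ : 0 < σ) (k : ℕ) :
    MeasurePreserving (fun x : Fin (k + 2) → ℝ => arrival μ σ ξ (x (Fin.last k).castSucc))
      (law μ σ ξ (k + 2)) (erlang k) :=
  (hasLaw_arrival_castSucc_last hσ k).measurePreserving
    ((measurable_arrival μ σ ξ).comp (measurable_pi_apply _))

lemma memLp_logLikDiff (hσ : 0 < σ) (k : ℕ) [IsProbabilityMeasure (law μ σ ξ (k + 2))] :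
    MemLp (logLikDiff μ σ ξ (k + 2)) 2 (law μ σ ξ (k + 2)) := by
  have hlast := measurePreserving_arrival_last (μ := μ) (ξ := ξ) hσ (k + 1)
  have hprev := measurePreserving_arrival_castSucc_last (μ := μ) (ξ := ξ) hσ k
  refine MemLp.ae_eq (logLikDiff_ae_eq μ σ ξ k).symm ?_
  have h1 := (memLp_id_erlang (k + 1)).comp_measurePreserving hlast
  have h2 := (memLp_log_erlang k).comp_measurePreserving hlast
  have h3 := (memLp_id_erlang k).comp_measurePreserving hprev
  exact (((memLp_const (-Real.log σ)).sub h1).add (h2.const_mul (1 + ξ))).add h3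

/-- With `r = k + 2` the mean is `-log σ - r + (1 + ξ) ψ(r) + (r - 1) = η_r`. -/
lemma integral_logLikDiff (hσ : 0 < σ) (k : ℕ) [IsProbabilityMeasure (law μ σ ξ (k + 2))] :
    ∫ x, logLikDiff μ σ ξ (k + 2) x ∂law μ σ ξ (k + 2) = eta σ ξ (k + 2) := by
  have hlast := measurePreserving_arrival_last (μ := μ) (ξ := ξ) hσ (k + 1)
  have hprev := measurePreserving_arrival_castSucc_last (μ := μ) (ξ := ξ) hσ k
  have h1 := ((memLp_id_erlang (k + 1)).comp_measurePreserving hlast).integrable (by norm_num)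
  have h2 := ((memLp_log_erlang k).comp_measurePreserving hlast).integrable (by norm_num)
  have h3 := ((memLp_id_erlang k).comp_measurePreserving hprev).integrable (by norm_num)
  have e1 := (hasLaw_arrival_last (μ := μ) (ξ := ξ) hσ (k + 1)).integral_comp
    (f := fun t => t) (by fun_prop)
  have e2 := (hasLaw_arrival_last (μ := μ) (ξ := ξ) hσ (k + 1)).integral_comp
    (f := Real.log) (by fun_prop)
  have e3 := (hasLaw_arrival_castSucc_last (μ := μ) (ξ := ξ) hσ k).integral_comp
    (f := fun t => t) (by fun_prop)
  rw [integral_id_erlang] at e1 e3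
  rw [integral_log_erlang] at e2
  simp only [Function.comp_def] at h1 h2 h3 e1 e2 e3
  have h0 : Integrable (fun _ => -Real.log σ) (law μ σ ξ (k + 2)) := integrable_const _
  have h01 : Integrable (fun x => -Real.log σ - arrival μ σ ξ (x (Fin.last (k + 1))))
    (law μ σ ξ (k + 2)) := h0.sub h1
  have h012 : Integrable (fun x => -Real.log σ - arrival μ σ ξ (x (Fin.last (k + 1))) +
      (1 + ξ) * Real.log (arrival μ σ ξ (x (Fin.last (k + 1))))) (law μ σ ξ (k + 2)) :=
    h01.add (h2.const_mul _)
  rw [integral_congr_ae (logLikDiff_ae_eq μ σ ξ k), integral_add h012 h3,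
    integral_add h01 (h2.const_mul _),
    integral_sub h0 h1, integral_const_mul, e1, e2, e3]
  simp only [integral_const, probReal_univ, smul_eq_mul, one_mul, eta]
  push_cast
  ring_nf

/-- If the variance were `0`, the last but one arrival time would be a function of the last one. -/
lemma variance_logLikDiff_ne_zero (hσ : 0 < σ) (k : ℕ)
    [IsProbabilityMeasure (law μ σ ξ (k + 2))] :
    Var[logLikDiff μ σ ξ (k + 2); law μ σ ξ (k + 2)] ≠ 0 := by
  intro h
  have h1 := ae_eq_integral_of_variance_eq_zero (memLp_logLikDiff hσ k) h
  set c := ∫ x, logLikDiff μ σ ξ (k + 2) x ∂law μ σ ξ (k + 2)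
  have h2 := ae_arrival_ne (μ := μ) (ξ := ξ) hσ k
    (φ := fun w => c + Real.log σ + w - (1 + ξ) * Real.log w) (by fun_prop)
  have h3 : ∀ᵐ x ∂law μ σ ξ (k + 2), False := by
    filter_upwards [h1, h2, logLikDiff_ae_eq μ σ ξ k] with x h1 h2 h3
    refine h2 ?_
    rw [← h1, h3]
    ring
  exact h3.exists.elim fun _ => id

end GEVr

theorem theorem1 {Ω : Type*} [MeasurableSpace Ω]
    (P : MeasureTheory.Measure Ω) [MeasureTheory.IsProbabilityMeasure P]
    (μ σ ξ : ℝ) (hσ : 0 < σ) (r : ℕ) (hr : 2 ≤ r)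
    (X : ℕ → Ω → (Fin r → ℝ))
    (hindep : ProbabilityTheory.iIndepFun X P)
    (hlaw : ∀ i, ProbabilityTheory.HasLaw (X i) (GEVr.law μ σ ξ r) P) :
    MeasureTheory.TendstoInDistribution
      (fun (n : ℕ) (ω : Ω) => GEVr.edStat μ σ ξ r n (fun i => X i ω))
      Filter.atTop (id : ℝ → ℝ) (fun _ => P) (ProbabilityTheory.gaussianReal 0 1) := by
  obtain ⟨k, rfl⟩ := Nat.exists_eq_add_of_le' hr
  have hprob : MeasureTheory.IsProbabilityMeasure (GEVr.law μ σ ξ (k + 2)) :=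
    (hlaw 0).isProbabilityMeasure_iff.1 inferInstance
  have hm := GEVr.measurable_logLikDiff μ σ ξ (k + 2)
  have hident : ∀ i, ProbabilityTheory.IdentDistrib (X i) (X 0) P P := fun i =>
    ⟨(hlaw i).aemeasurable, (hlaw 0).aemeasurable, by rw [(hlaw i).map_eq, (hlaw 0).map_eq]⟩
  have hY : MeasureTheory.MemLp (GEVr.logLikDiff μ σ ξ (k + 2) ∘ X 0) 2 P := by
    rw [← MeasureTheory.memLp_map_measure_iff hm.aestronglyMeasurable (hlaw 0).aemeasurable,
      (hlaw 0).map_eq]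
    exact GEVr.memLp_logLikDiff hσ k
  have hmean : ∫ ω, GEVr.logLikDiff μ σ ξ (k + 2) (X 0 ω) ∂P = GEVr.eta σ ξ (k + 2) :=
    ((hlaw 0).integral_comp hm.aestronglyMeasurable).trans (GEVr.integral_logLikDiff hσ k)
  have hvar : ProbabilityTheory.variance (GEVr.logLikDiff μ σ ξ (k + 2) ∘ X 0) P ≠ 0 := by
    rw [← ProbabilityTheory.variance_map hm.aemeasurable (hlaw 0).aemeasurable, (hlaw 0).map_eq]
    exact GEVr.variance_logLikDiff_ne_zero hσ k
  have := GEVr.tendstoInDistribution_studentized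
    (Y := fun i ω => GEVr.logLikDiff μ σ ξ (k + 2) (X i ω))
    (hindep.comp (fun _ => GEVr.logLikDiff μ σ ξ (k + 2)) fun _ => hm)
    (fun i => (hident i).comp hm) hY hvar
  rw [hmean] at this
  exact this
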